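/- For a graph $G$ and a graph $F$, let $\mathrm{ex}(G,F)$ be the maximum number of edges in a subgraph of $G$ that contains no copy of $F$ (induced or not). Let $P_k$ be the path on $k$ vertices, and let $G(N,p)$ be the binomial random graph on $N$ labelled vertices in which each pair of vertices is an edge independently with probability $p\in[0,1]$. Let $N=N(n)$ be positive integers with $N\ge n e^{2n}$ for all sufficiently large $n$, and let $p=p(n)\in[0,1]$. All logarithms are natural. (i) If $p\ge N^{-2/(5n)}$ for all sufficiently large $n$, then $$\Pr\left(\tfrac1{16}\,nN\le \mathrm{ex}(G(N,p),P_{n+1})\le \tfrac12\,nN\right)\longrightarrow 1\qquad(n\to\infty).$$ (ii) If $N^{-1}\le p\le N^{-2/(5n)}$ for all sufficiently large $n$, then, with $\omega=\omega(n)=\dfrac{\log N}{np}$, $$\Pr\left(\tfrac1{75}\,\frac{\omega}{\log\omega}\,pnN\le \mathrm{ex}(G(N,p),P_{n+1})\le 8\,\frac{\omega}{\log\omega}\,pnN\right)\longrightarrow 1\qquad(n\to\infty).$$ -/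

import Mathlib

open MeasureTheory ProbabilityTheory Filter Topology unitInterval SimpleGraph

/-- `ex(G, F)`: the maximum number of edges of an `F`-free spanning subgraph `H` of `G`, where
`F`-free means that `H` contains no (not necessarily induced) copy of `F`. For `G` complete
this is the extremal number `SimpleGraph.extremalNumber`. -/
noncomputable def exNumber {V W : Type*} [Fintype V] (G : SimpleGraph V) (F : SimpleGraph W) : ℕ :=
  open scoped Classical in
  Finset.sup {H : SimpleGraph V | H ≤ G ∧ F.Free H} (fun H => H.edgeFinset.card)

/-- The event that `a ≤ ex(G, P_k) ≤ b`, where `P_k` is the path on `k` vertices and `G` is a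
graph on `M` labelled vertices. -/
def exPathBetween (M k : ℕ) (a b : ℝ) : Set (SimpleGraph (Fin M)) :=
  {G | a ≤ (exNumber G (pathGraph k) : ℝ) ∧ (exNumber G (pathGraph k) : ℝ) ≤ b}

/-! The upper bound in (i) is Erdős–Gallai and holds for every graph
(`sum_degIn_le_of_pathGraph_free`).

For the upper bound in (ii), take a depth-first search forest of a `P_{n+1}`-free subgraph
(`exists_normal_forest`). Its height is below `n` and every edge joins a vertex to an ancestor, so
all edges lie among at most `nN` pairs determined by the parent function. There are `N^N = exp(N log
N)` functions, and for each one the chance that the required number of its pairs are edges is at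
most `exp(-4 N log N)`; a union bound finishes (`binomialRandom_lt_exNumber_le`).

For the lower bounds, cut at most half of the vertices into `N/(2k)` disjoint blocks of size `k`,
and join each outside vertex to one block, if any, to which it is completely adjacent. A path stays
with one block and each of its edges uses a block vertex, so it has at most `2k+1` vertices
(`card_mul_le_exNumber_pathGraph`). Outside vertices succeed independently, with probability bounded
below once `p^k ≥ N^{-1/6}`, and Chebyshev gives order `kN` edges (`binomialRandom_exNumber_lt_le`).
In (i) take `k ≈ 5n/12`; in (ii) take `k ≈ log N / (6 log(1/p))`, or `k = 1` if this is below 1. The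
latter has the right order because `log ω ≥ log(1/p)`. -/

/-! ### Longest paths and the Erdős–Gallai theorem -/

/-- A duplicate-free list of consecutively adjacent vertices is a copy of a path graph. -/
theorem pathGraph_isContained_of_isChain {V : Type*} {H : SimpleGraph V} {l : List V}
    (hc : l.IsChain H.Adj) (hd : l.Nodup) {m : ℕ} (hm : m ≤ l.length) : pathGraph m ⊑ H := by
  rw [List.isChain_iff_getElem] at hc
  refine ⟨⟨⟨fun i => l[i.1]'(i.2.trans_le hm), ?_⟩, ?_⟩⟩
  · rintro ⟨a, ha⟩ ⟨b, hb⟩ h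
    rcases pathGraph_adj.1 h with h | h <;> dsimp only at h ⊢
    · subst h; exact hc a (by omega)
    · subst h; exact (hc b (by omega)).symm
  · rintro ⟨a, ha⟩ ⟨b, hb⟩ h
    simpa [hd.getElem_inj_iff] using h

/-- The list `l` is a path of `H` inside `S`. -/
structure IsPathIn {V : Type*} (H : SimpleGraph V) (S : Finset V) (l : List V) : Prop where
  isChain : l.IsChain H.Adj
  nodup : l.Nodup
  mem : ∀ x ∈ l, x ∈ S

theorem IsPathIn.reverse {V : Type*} {H : SimpleGraph V} {S : Finset V} {l : List V}
    (h : IsPathIn H S l) : IsPathIn H S l.reverse where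
  isChain := by
    rw [List.isChain_reverse]
    exact h.isChain.imp fun _ _ h => h.symm
  nodup := List.nodup_reverse.2 h.nodup
  mem x hx := h.mem x (by simpa using hx)

/-- A cyclic list of vertices can be extended to a longer path through any outside neighbour. -/
theorem exists_longer_of_cycle {V : Type*} {H : SimpleGraph V} {S : Finset V} {c : List V}
    (hc : IsPathIn H S c) (hcl : ∀ x ∈ c.getLast?, ∀ y ∈ c.head?, H.Adj x y)
    {x w : V} (hx : x ∈ c) (hw : w ∈ S) (hwc : w ∉ c) (hxw : H.Adj x w) :
    ∃ l, IsPathIn H S l ∧ l.length = c.length + 1 := by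
  -- Rotate the cycle so that it starts at `x`, then put `w` in front.
  obtain ⟨c₁, c₂, rfl⟩ := List.append_of_mem hx
  refine ⟨w :: (x :: c₂ ++ c₁), ⟨?_, ?_, ?_⟩, by simp; omega⟩
  · have h1 := hc.isChain
    rw [List.isChain_append] at h1
    rw [List.isChain_cons]
    refine ⟨by simpa using hxw.symm, ?_⟩
    rw [List.isChain_append]
    refine ⟨h1.2.1, h1.1, fun a ha b hb => hcl a ?_ b ?_⟩
    · rw [List.getLast?_append]
      simp only [Option.mem_def] at ha
      simp [ha]
    · rw [List.head?_append]
      simp only [Option.mem_def] at hb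
      simp [hb]
  · rw [List.nodup_cons]
    refine ⟨fun h => hwc ?_, ?_⟩
    · simp only [List.mem_append, List.mem_cons] at h ⊢
      tauto
    · exact (List.perm_append_comm.nodup_iff).1 hc.nodup
  · intro y hy
    rcases List.mem_cons.1 hy with rfl | hy
    · exact hw
    · apply hc.mem
      simp only [List.mem_append, List.mem_cons] at hy ⊢
      tauto

section
open scoped Classical

/-- The number of neighbours of `v` inside `S`. -/
noncomputable def degIn {V : Type*} (H : SimpleGraph V) (S : Finset V) (v : V) : ℕ :=
  (S.filter (H.Adj v)).card

/-- The neighbours of the first vertex of a longest path lie on the path. -/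
theorem IsPathIn.mem_of_adj_head {V : Type*} {H : SimpleGraph V} {S : Finset V} {l : List V}
    (h : IsPathIn H S l) (hmax : ∀ l', IsPathIn H S l' → l'.length ≤ l.length) (hl : 0 < l.length)
    {u : V} (hu : u ∈ S) (ha : H.Adj l[0] u) : u ∈ l := by
  by_contra hul
  have := hmax (u :: l) ⟨?_, List.nodup_cons.2 ⟨hul, h.nodup⟩, ?_⟩
  · simp at this
  · rw [List.isChain_cons]
    refine ⟨fun y hy => ?_, h.isChain⟩
    rw [List.head?_eq_getElem?, List.getElem?_eq_getElem hl] at hy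
    simp only [Option.mem_def, Option.some.injEq] at hy
    exact hy ▸ ha.symm
  · intro x hx
    rcases List.mem_cons.1 hx with rfl | hx
    exacts [hu, h.mem x hx]

theorem IsPathIn.mem_of_adj_last {V : Type*} {H : SimpleGraph V} {S : Finset V} {l : List V}
    (h : IsPathIn H S l) (hmax : ∀ l', IsPathIn H S l' → l'.length ≤ l.length) (hl : 0 < l.length)
    {u : V} (hu : u ∈ S) (ha : H.Adj (l[l.length - 1]) u) : u ∈ l := by
  have := h.reverse.mem_of_adj_head (u := u) (by simpa using hmax) (by simpa using hl) hu
    (by simpa using ha)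
  simpa using this

/-- If the end vertices of a longest path in `S` have large degree sum, then the vertex set of
that path carries a cycle and hence has no neighbours in the rest of `S`. -/
theorem IsPathIn.isolated_of_degree {V : Type*} {H : SimpleGraph V} {S : Finset V} {l : List V}
    (h : IsPathIn H S l) (hmax : ∀ l', IsPathIn H S l' → l'.length ≤ l.length) (hl : 0 < l.length)
    (hdeg : l.length ≤ degIn H S l[0] + degIn H S (l[l.length - 1]))
    {x w : V} (hx : x ∈ l) (hw : w ∈ S) (hxw : H.Adj x w) : w ∈ l := by
  by_contra hwl
  obtain ⟨m, hm⟩ : ∃ m, l.length = m + 1 := ⟨l.length - 1, by omega⟩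
  set v : ℕ → V := fun i => l.getD i x with hv
  have hvi : ∀ i (hi : i < l.length), v i = l[i] := fun i hi => by simp [hv, hi]
  -- Pósa's crossing chords: `A` and `B` live on the same `m` positions and have total size at least
  -- `m + 1`, so some `i` has both chords `v 0 – v (i+1)` and `v i – v m`.
  set A := (Finset.range m).filter fun i => H.Adj (v 0) (v (i + 1)) with hA
  set B := (Finset.range m).filter fun i => H.Adj (v i) (v m) with hB
  have h0 : l[0] = v 0 := (hvi 0 hl).symm
  have hlast : l[l.length - 1] = v m := by rw [hvi m (by omega)]; congr 1; omega
  have hAc : degIn H S l[0] ≤ A.card := by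
    refine le_trans (Finset.card_le_card ?_) (Finset.card_image_le (f := fun i => v (i + 1)))
    intro u hu
    obtain ⟨huS, hua⟩ := Finset.mem_filter.1 hu
    obtain ⟨i, hi, rfl⟩ := List.getElem_of_mem (h.mem_of_adj_head hmax hl huS hua)
    have hi0 : i ≠ 0 := by rintro rfl; exact H.irrefl hua
    refine Finset.mem_image.2 ⟨i - 1, Finset.mem_filter.2 ⟨Finset.mem_range.2 (by omega), ?_⟩, ?_⟩
    · rw [Nat.sub_add_cancel (by omega), ← h0, hvi i hi]; exact hua
    · rw [Nat.sub_add_cancel (by omega), hvi i hi]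
  have hBc : degIn H S (l[l.length - 1]) ≤ B.card := by
    refine le_trans (Finset.card_le_card ?_) (Finset.card_image_le (f := fun i => v i))
    intro u hu
    obtain ⟨huS, hua⟩ := Finset.mem_filter.1 hu
    obtain ⟨i, hi, rfl⟩ := List.getElem_of_mem (h.mem_of_adj_last hmax hl huS hua)
    have him : i ≠ m := by
      rintro rfl
      rw [hlast, hvi i hi] at hua
      exact H.irrefl hua
    refine Finset.mem_image.2 ⟨i, Finset.mem_filter.2 ⟨Finset.mem_range.2 (by omega), ?_⟩, ?_⟩
    · rw [← hlast, hvi i hi]; exact hua.symm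
    · exact hvi i hi
  obtain ⟨i, hi⟩ := Finset.inter_nonempty_of_card_lt_card_add_card (s := Finset.range m)
    (t := A) (u := B) (Finset.filter_subset _ _) (Finset.filter_subset _ _)
    (by rw [Finset.card_range]; omega)
  obtain ⟨hiA, hiB⟩ := Finset.mem_inter.1 hi
  obtain ⟨him, hiA⟩ := Finset.mem_filter.1 hiA
  obtain ⟨-, hiB⟩ := Finset.mem_filter.1 hiB
  rw [Finset.mem_range] at him
  have hchain := h.isChain
  have hnd := h.nodup
  rw [← List.take_append_drop (i + 1) l] at hchain hnd
  rw [List.isChain_append] at hchain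
  have hmem : ∀ y, y ∈ l.take (i + 1) ++ (l.drop (i + 1)).reverse ↔ y ∈ l := fun y => by
    rw [List.mem_append, List.mem_reverse, ← List.mem_append, List.take_append_drop]
  have hlast1 : (l.take (i + 1)).getLast? = some (v i) := by
    rw [List.getLast?_take]
    simp [hvi i (by omega), List.getElem?_eq_getElem (show i < l.length by omega)]
  have hhead2 : (l.drop (i + 1)).head? = some (v (i + 1)) := by
    rw [List.head?_drop, List.getElem?_eq_getElem (by omega), hvi (i + 1) (by omega)]
  have hlast2 : (l.drop (i + 1)).getLast? = some (v m) := by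
    rw [List.getLast?_drop, if_neg (by omega), List.getLast?_eq_getElem?, hm, hvi m (by omega),
      List.getElem?_eq_getElem (by omega)]
    rfl
  -- The cycle is `v 0, …, v i, v m, …, v (i+1)`, closed up by the chord from `v (i+1)` to `v 0`.
  have hcyc : IsPathIn H S (l.take (i + 1) ++ (l.drop (i + 1)).reverse) := by
    refine ⟨?_, ?_, fun y hy => h.mem y ((hmem y).1 hy)⟩
    · rw [List.isChain_append]
      refine ⟨hchain.1, ?_, ?_⟩
      · rw [List.isChain_reverse]
        exact hchain.2.1.imp fun _ _ h => h.symm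
      · rw [hlast1, List.head?_reverse, hlast2]
        simpa using hiB
    · exact ((List.reverse_perm _).append_left _).nodup_iff.2 hnd
  have hcl : ∀ a ∈ (l.take (i + 1) ++ (l.drop (i + 1)).reverse).getLast?,
      ∀ b ∈ (l.take (i + 1) ++ (l.drop (i + 1)).reverse).head?, H.Adj a b := by
    rw [List.getLast?_append, List.head?_append, List.getLast?_reverse, hhead2, List.head?_take,
      if_neg (by omega), List.head?_eq_getElem?, List.getElem?_eq_getElem hl, h0]
    simpa using hiA.symm
  obtain ⟨l', hl', hlen⟩ := exists_longer_of_cycle hcyc hcl ((hmem x).2 hx) hw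
    (fun h => hwl ((hmem w).1 h)) hxw
  have := hmax l' hl'
  simp at hlen
  omega

theorem exists_longest_path {V : Type*} (H : SimpleGraph V) {S : Finset V} (hS : S.Nonempty) :
    ∃ l, IsPathIn H S l ∧ 0 < l.length ∧ ∀ l', IsPathIn H S l' → l'.length ≤ l.length := by
  obtain ⟨x, hx⟩ := hS
  have hbd : ∀ l, IsPathIn H S l → l.length ≤ S.card := fun l hl => by
    rw [← List.toFinset_card_of_nodup hl.nodup]
    exact Finset.card_le_card fun y hy => hl.mem y (List.mem_toFinset.1 hy)
  have h1 : IsPathIn H S [x] := ⟨by simp, by simp, by simpa using hx⟩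
  obtain ⟨l, hl, hlen⟩ := Nat.findGreatest_spec (P := fun m => ∃ l, IsPathIn H S l ∧ l.length = m)
    (hbd _ h1) ⟨_, h1, rfl⟩
  have hmax : ∀ l', IsPathIn H S l' → l'.length ≤ l.length := fun l' hl' =>
    hlen ▸ Nat.le_findGreatest (hbd _ hl') ⟨_, hl', rfl⟩
  exact ⟨l, hl, hmax _ h1, hmax⟩

theorem sum_degIn_erase {V : Type*} (H : SimpleGraph V) {S : Finset V} {v : V} (hv : v ∈ S) :
    ∑ u ∈ S, degIn H S u = ∑ u ∈ S.erase v, degIn H (S.erase v) u + 2 * degIn H S v := by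
  have hS : S = insert v (S.erase v) := (Finset.insert_erase hv).symm
  have hd : ∀ u ∈ S.erase v, degIn H S u = degIn H (S.erase v) u + if H.Adj v u then 1 else 0 := by
    intro u hu
    unfold degIn
    conv_lhs => rw [hS]
    rw [Finset.filter_insert]
    by_cases h : H.Adj u v
    · rw [if_pos h, if_pos h.symm, Finset.card_insert_of_notMem (by simp)]
    · rw [if_neg h, if_neg (fun h' => h h'.symm), add_zero]
  rw [← Finset.add_sum_erase S _ hv, Finset.sum_congr rfl hd, Finset.sum_add_distrib,
    ← Finset.card_filter]
  have : degIn H S v = ((S.erase v).filter (H.Adj v)).card := by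
    unfold degIn
    conv_lhs => rw [hS]
    rw [Finset.filter_insert, if_neg (H.irrefl)]
  rw [this]; ring

/-- **Erdős–Gallai**, for the subgraph induced on a set of vertices. -/
theorem sum_degIn_le_of_pathGraph_free {V : Type*} (H : SimpleGraph V) {n : ℕ}
    (hH : (pathGraph (n + 2)).Free H) (S : Finset V) : ∑ v ∈ S, degIn H S v ≤ n * S.card := by
  induction S using Finset.strongInduction with
  | H S ih =>
  rcases S.eq_empty_or_nonempty with rfl | hS
  · simp
  -- Deleting a vertex of degree at most `n / 2` lowers the degree sum by at most `n`.
  by_cases hlow : ∃ v ∈ S, 2 * degIn H S v ≤ n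
  · obtain ⟨v, hv, hdv⟩ := hlow
    have := ih _ (Finset.erase_ssubset hv)
    rw [sum_degIn_erase H hv, ← Finset.card_erase_add_one hv, mul_add, mul_one]
    omega
  push Not at hlow
  -- Now all degrees exceed `n / 2`, so the two ends of a longest path have degree sum at least `n +
  -- 1`, which is at least its length. Its vertex set is then cut off from the rest of `S` and can
  -- be removed, each degree in it being at most `n`.
  obtain ⟨l, hl, hpos, hmax⟩ := exists_longest_path H hS
  have hlen : l.length ≤ n + 1 := by
    by_contra h
    exact hH (pathGraph_isContained_of_isChain hl.isChain hl.nodup (by omega))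
  have hiso : ∀ {x w : V}, x ∈ l → w ∈ S → H.Adj x w → w ∈ l := fun hx hw hxw =>
    hl.isolated_of_degree hmax hpos (by
      have h1 := hlow l[0] (hl.mem _ (List.getElem_mem _))
      have h2 := hlow (l[l.length - 1]) (hl.mem _ (List.getElem_mem _))
      omega) hx hw hxw
  set T := l.toFinset with hT
  have hTS : T ⊆ S := fun x hx => hl.mem x (List.mem_toFinset.1 hx)
  have hTc : T.card = l.length := List.toFinset_card_of_nodup hl.nodup
  have hrest := ih (S \ T) (Finset.sdiff_ssubset hTS ⟨l[0], by simp [hT]⟩)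
  have hin : ∀ v ∈ T, degIn H S v ≤ n := by
    intro v hv
    have : S.filter (H.Adj v) ⊆ T.erase v := fun u hu => by
      obtain ⟨huS, hua⟩ := Finset.mem_filter.1 hu
      exact Finset.mem_erase.2 ⟨hua.ne', List.mem_toFinset.2 (hiso (List.mem_toFinset.1 hv) huS hua)⟩
    have := Finset.card_le_card this
    rw [Finset.card_erase_of_mem hv] at this
    unfold degIn
    omega
  have hout : ∀ v ∈ S \ T, degIn H S v = degIn H (S \ T) v := by
    intro v hv
    obtain ⟨hvS, hvT⟩ := Finset.mem_sdiff.1 hv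
    unfold degIn
    congr 1
    ext u
    simp only [Finset.mem_filter, Finset.mem_sdiff]
    refine ⟨fun ⟨hu, ha⟩ => ⟨⟨hu, fun huT => hvT ?_⟩, ha⟩, fun h => ⟨h.1.1, h.2⟩⟩
    exact List.mem_toFinset.2 (hiso (List.mem_toFinset.1 huT) hvS ha.symm)
  rw [← Finset.sum_sdiff hTS, Finset.sum_congr rfl hout, ← Finset.card_sdiff_add_card_eq_card hTS,
    mul_add]
  refine add_le_add hrest ?_
  rw [mul_comm]
  exact Finset.sum_le_card_nsmul _ _ _ hin

/-- **Erdős–Gallai**: a graph without a path on `n + 2` vertices has at most `n / 2` edges per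
vertex. -/
theorem two_mul_card_edgeFinset_le_of_pathGraph_free {V : Type*} [Fintype V] (H : SimpleGraph V)
    {n : ℕ} (hH : (pathGraph (n + 2)).Free H) :
    2 * H.edgeFinset.card ≤ n * Fintype.card V := by
  have := sum_degIn_le_of_pathGraph_free H hH Finset.univ
  rw [← sum_degrees_eq_twice_card_edges, ← Finset.card_univ]
  refine le_of_eq_of_le (Finset.sum_congr rfl fun v _ => ?_) this
  unfold degIn
  rw [← card_neighborFinset_eq_degree]
  congr 1
  ext u
  simp

end

/-! ### Depth-first search forests -/

/-- A rooted spanning forest of `H`, given by its parent function `f` and its depth function `d`.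
Roots are their own parents. -/
def IsRootedForest {V : Type*} (H : SimpleGraph V) (f : V → V) (d : V → ℕ) : Prop :=
  ∀ v, (d v = 0 ∧ f v = v) ∨ (H.Adj v (f v) ∧ d v = d (f v) + 1)

namespace IsRootedForest

variable {V : Type*} {H : SimpleGraph V} {f : V → V} {d : V → ℕ}

theorem depth_iterate (h : IsRootedForest H f d) (v : V) {i : ℕ} (hi : i ≤ d v) :
    d (f^[i] v) = d v - i := by
  induction i with
  | zero => simp
  | succ i ih =>
    have := ih (by omega)
    rw [Function.iterate_succ_apply']
    rcases h (f^[i] v) with h' | h' <;> omega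

theorem pathGraph_isContained (h : IsRootedForest H f d) (v : V) :
    pathGraph (d v + 1) ⊑ H := by
  refine pathGraph_isContained_of_isChain (l := (List.range (d v + 1)).map fun i => f^[i] v)
    ?_ ?_ (by simp)
  · rw [List.isChain_iff_getElem]
    intro i hi
    simp only [List.length_map, List.length_range] at hi
    simp only [List.getElem_map, List.getElem_range]
    rw [Function.iterate_succ_apply']
    have := h.depth_iterate v (i := i) (by omega)
    rcases h (f^[i] v) with h' | h'
    · omega
    · exact h'.1
  · refine List.Nodup.map_on ?_ List.nodup_range
    intro a ha b hb hab
    rw [List.mem_range] at ha hb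
    have h1 := h.depth_iterate v (i := a) (by omega)
    have h2 := h.depth_iterate v (i := b) (by omega)
    rw [hab] at h1
    omega

theorem depth_lt_card [Fintype V] (h : IsRootedForest H f d) (v : V) :
    d v < Fintype.card V := by
  obtain ⟨c⟩ := h.pathGraph_isContained v
  simpa using Fintype.card_le_of_injective _ c.injective

theorem iterate_eq_of_depth_le (h : IsRootedForest H f d) (v : V) {j : ℕ} (hj : d v ≤ j) :
    f^[j] v = f^[d v] v := by
  have hroot : f (f^[d v] v) = f^[d v] v := by
    have := h.depth_iterate v le_rfl
    rcases h (f^[d v] v) with h' | h'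
    · exact h'.2
    · omega
  obtain ⟨c, rfl⟩ := Nat.exists_eq_add_of_le' hj
  rw [Function.iterate_add_apply]
  exact Function.iterate_fixed hroot c

/-- Hanging the subtree at `v` below an adjacent vertex `u` outside of that subtree. -/
theorem exists_rehang (h : IsRootedForest H f d) [Fintype V] {u v : V} (ha : H.Adj u v)
    (hd : d v ≤ d u) (hu : ∀ j, f^[j] u ≠ v) :
    ∃ f' d', IsRootedForest H f' d' ∧ ∑ w, d w < ∑ w, d' w := by
  classical
  have hstep : ∀ w, w ≠ v → ((∃ j, f^[j] w = v) ↔ ∃ j, f^[j] (f w) = v) := by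
    intro w hw
    constructor
    · rintro ⟨j, hj⟩
      cases j with
      | zero => exact absurd hj hw
      | succ j => exact ⟨j, hj⟩
    · rintro ⟨j, hj⟩
      exact ⟨j + 1, hj⟩
  have hv : ∃ j, f^[j] v = v := ⟨0, rfl⟩
  have hu' : ¬ ∃ j, f^[j] u = v := fun ⟨j, hj⟩ => hu j hj
  -- The subtree of `v` consists of the `w` with `v` among their iterates. It moves down as a whole
  -- by `d u + 1 - d v ≥ 1`, while `u`, lying outside it, keeps its depth.
  refine ⟨Function.update f v u, fun w => if ∃ j, f^[j] w = v then d w + (d u + 1 - d v) else d w,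
    fun w => ?_, ?_⟩
  · by_cases hw : w = v
    · subst hw
      right
      simp only [Function.update_self, if_pos hv, if_neg hu']
      exact ⟨ha.symm, by omega⟩
    · simp only [Function.update_of_ne hw]
      by_cases hwv : ∃ j, f^[j] w = v
      · have hfw := (hstep w hw).1 hwv
        simp only [if_pos hwv, if_pos hfw]
        rcases h w with h' | h'
        · obtain ⟨j, hj⟩ := hwv
          rw [Function.iterate_fixed h'.2] at hj
          exact absurd hj hw
        · exact Or.inr ⟨h'.1, by omega⟩
      · have hfw : ¬ ∃ j, f^[j] (f w) = v := fun h' => hwv ((hstep w hw).2 h')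
        simp only [if_neg hwv, if_neg hfw]
        exact h w
  · refine Finset.sum_lt_sum (fun w _ => ?_) ⟨v, Finset.mem_univ _, ?_⟩
    · split_ifs <;> omega
    · simp only [if_pos hv]
      omega

end IsRootedForest

/-- Every finite graph has a depth-first search forest: each edge joins a vertex to one of its
ancestors. -/
theorem exists_normal_forest {V : Type*} [Fintype V] (H : SimpleGraph V) :
    ∃ f d, IsRootedForest H f d ∧
      ∀ u v, H.Adj u v → (∃ j, f^[j] u = v) ∨ ∃ j, f^[j] v = u := by
  classical
  have hbd : ∀ f d, IsRootedForest H f d → ∑ w, d w ≤ Fintype.card V * Fintype.card V :=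
    fun f d h => by
      simpa using Finset.sum_le_card_nsmul Finset.univ d _ fun v _ => (h.depth_lt_card v).le
  have h0 : IsRootedForest H id fun _ => 0 := fun v => Or.inl ⟨rfl, rfl⟩
  -- A forest with maximal depth sum is normal, since an edge between unrelated vertices would allow
  -- a rehanging that increases the sum.
  obtain ⟨f, d, h, hs⟩ := Nat.findGreatest_spec
    (P := fun m => ∃ f d, IsRootedForest H f d ∧ ∑ w, d w = m) (hbd _ _ h0) ⟨_, _, h0, rfl⟩
  have hmax : ∀ f' d', IsRootedForest H f' d' → ∑ w, d' w ≤ ∑ w, d w := fun f' d' h' =>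
    hs ▸ Nat.le_findGreatest (hbd _ _ h') ⟨_, _, h', rfl⟩
  have key : ∀ u v, H.Adj u v → d v ≤ d u → ∃ j, f^[j] u = v := by
    intro u v ha hd
    by_contra! hu
    obtain ⟨f', d', h', hlt⟩ := h.exists_rehang ha hd hu
    exact absurd (hmax f' d' h') (by omega)
  refine ⟨f, d, h, fun u v ha => ?_⟩
  rcases le_total (d v) (d u) with hd | hd
  · exact Or.inl (key u v ha hd)
  · exact Or.inr (key v u ha.symm hd)

/-! ### Deterministic bounds on `exNumber` -/

section
open scoped Classical

/-- The pairs formed by a vertex and one of its first `n` iterates under `f`. -/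
noncomputable def iteratePairs {V : Type*} [Fintype V] (f : V → V) (n : ℕ) : Finset (Sym2 V) :=
  (Finset.univ ×ˢ Finset.range n).image fun x : V × ℕ => s(x.1, f^[x.2] x.1)

theorem card_iteratePairs_le {V : Type*} [Fintype V] (f : V → V) (n : ℕ) :
    (iteratePairs f n).card ≤ n * Fintype.card V := by
  refine Finset.card_image_le.trans ?_
  simp [mul_comm]

/-- The edges of a graph without a path on `n + 1` vertices lie among the pairs of a vertex and
one of its ancestors in some forest of height less than `n`. -/
theorem exists_edgeFinset_subset_iteratePairs {V : Type*} [Fintype V] {H : SimpleGraph V} {n : ℕ}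
    (hH : (pathGraph (n + 1)).Free H) : ∃ f : V → V, H.edgeFinset ⊆ iteratePairs f n := by
  obtain ⟨f, d, h, hf⟩ := exists_normal_forest H
  have hdn : ∀ v, d v < n := fun v => by
    by_contra! hv
    obtain ⟨c⟩ := h.pathGraph_isContained v
    refine hH ?_
    refine IsContained.trans ?_ ⟨c⟩
    exact pathGraph_isContained_of_isChain (l := List.finRange (d v + 1))
      (by
        rw [List.isChain_iff_getElem]
        intro i hi
        simp [pathGraph_adj])
      (List.nodup_finRange _) (by simpa using hv)
  have key : ∀ u v, (∃ j, f^[j] u = v) → s(u, v) ∈ iteratePairs f n := by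
    rintro u _ ⟨j, rfl⟩
    by_cases hj : j < n
    · exact Finset.mem_image.2 ⟨(u, j), by simpa using hj, rfl⟩
    -- From index `d u` on, the iterates stay at the root, so `j` may be replaced by `d u < n`.
    · refine Finset.mem_image.2 ⟨(u, d u), by simpa using hdn u, ?_⟩
      dsimp only
      rw [h.iterate_eq_of_depth_le u (j := j) (by have := hdn u; omega)]
  refine ⟨f, fun e he => ?_⟩
  induction e using Sym2.ind with
  | _ u v =>
    rcases hf u v (by simpa using he) with h' | h'
    · exact key u v h'
    · rw [Sym2.eq_swap]; exact key v u h'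

theorem card_edgeFinset_le_exNumber {V W : Type*} [Fintype V] {G H : SimpleGraph V}
    {F : SimpleGraph W} (hle : H ≤ G) (hF : F.Free H) : H.edgeFinset.card ≤ exNumber G F := by
  unfold exNumber
  have := Finset.le_sup (s := {H : SimpleGraph V | H ≤ G ∧ F.Free H})
    (f := fun H => H.edgeFinset.card) (b := H) (Finset.mem_filter.2 ⟨Finset.mem_univ _, hle, hF⟩)
  exact this

theorem exists_of_lt_exNumber {V W : Type*} [Fintype V] {G : SimpleGraph V}
    {F : SimpleGraph W} {m : ℕ} (h : m < exNumber G F) :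
    ∃ H ≤ G, F.Free H ∧ m < H.edgeFinset.card := by
  unfold exNumber at h
  obtain ⟨H, hH, hm⟩ := Finset.lt_sup_iff.1 h
  simp only [Finset.mem_filter, Finset.mem_univ, true_and] at hH
  exact ⟨H, hH.1, hH.2, hm⟩

theorem two_mul_exNumber_pathGraph_le {V : Type*} [Fintype V] (G : SimpleGraph V) (n : ℕ) :
    2 * exNumber G (pathGraph (n + 2)) ≤ n * Fintype.card V := by
  by_contra! h
  obtain ⟨H, -, hF, hm⟩ := exists_of_lt_exNumber (m := n * Fintype.card V / 2)
    (G := G) (F := pathGraph (n + 2)) (by omega)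
  have := two_mul_card_edgeFinset_le_of_pathGraph_free H hF
  omega

/-- If `G` has a subgraph with more than `m` edges and no path on `n + 1` vertices, then some
`m + 1` edges of `G` are among the pairs of a vertex and one of its first `n` iterates under some
function. -/
theorem exists_subset_iteratePairs_of_lt_exNumber {V : Type*} [Fintype V] {G : SimpleGraph V}
    {n m : ℕ} (h : m < exNumber G (pathGraph (n + 1))) :
    ∃ f : V → V, ∃ T ∈ (iteratePairs f n).powersetCard (m + 1), ∀ e ∈ T, e ∈ G.edgeSet := by
  obtain ⟨H, hle, hF, hm⟩ := exists_of_lt_exNumber h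
  obtain ⟨f, hf⟩ := exists_edgeFinset_subset_iteratePairs hF
  obtain ⟨T, hT, hTc⟩ := Finset.exists_subset_card_eq (show m + 1 ≤ H.edgeFinset.card from hm)
  exact ⟨f, T, Finset.mem_powersetCard.2 ⟨hT.trans hf, hTc⟩,
    fun e he => edgeSet_mono hle (by simpa using hT he)⟩

/-- If the edges of `H` respect a colouring and each edge meets `C`, and each colour class has at
most `k` vertices in `C`, then `H` has no path on `2 * k + 2` or more vertices. -/
theorem pathGraph_free_of_cover {V ι : Type*} [Fintype V] {H : SimpleGraph V} (C : Finset V)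
    (col : V → ι) (hcol : ∀ u v, H.Adj u v → col u = col v) (hC : ∀ u v, H.Adj u v → u ∈ C ∨ v ∈ C)
    {k m : ℕ} (hk : ∀ i, (C.filter fun v => col v = i).card ≤ k) (hm : 2 * k + 2 ≤ m) :
    (pathGraph m).Free H := by
  rintro ⟨c⟩
  have hadj : ∀ i (hi : i + 1 < m), H.Adj (c ⟨i, by omega⟩) (c ⟨i + 1, hi⟩) := fun i hi =>
    c.toHom.map_adj (pathGraph_adj.2 (Or.inl rfl))
  have hconst : ∀ i (hi : i < m), col (c ⟨i, hi⟩) = col (c ⟨0, by omega⟩) := by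
    intro i
    induction i with
    | zero => intro _; rfl
    | succ i ih =>
      intro hi
      rw [← hcol _ _ (hadj i hi)]
      exact ih _
  -- The first `2 * k + 2` vertices form `k + 1` disjoint edges of the path; each contributes its
  -- own vertex of `C`, all of one colour.
  have hpick : ∀ j : Fin (k + 1), ∃ a : Fin m, a.1 / 2 = j.1 ∧ c a ∈ C := by
    intro j
    rcases hC _ _ (hadj (2 * j.1) (by omega)) with h | h
    · exact ⟨_, by simp, h⟩
    · exact ⟨_, by simp only; omega, h⟩
  choose a ha haC using hpick
  have hinj : Function.Injective fun j => c (a j) := fun i j hij => by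
    have := c.injective hij
    exact Fin.ext (by rw [← ha i, ← ha j, this])
  have := (Finset.card_image_of_injective Finset.univ hinj).symm.le.trans
    ((Finset.card_le_card ?_).trans (hk (col (c ⟨0, by omega⟩))))
  · simp at this
  · intro x hx
    obtain ⟨j, -, rfl⟩ := Finset.mem_image.1 hx
    exact Finset.mem_filter.2 ⟨haC j, hconst _ _⟩

/-- Let `b` consist of disjoint blocks of `k` vertices. Joining to a block each outside vertex
that is adjacent to all of that block gives a subgraph without paths on `2 * k + 2` vertices. -/
theorem card_mul_le_exNumber_pathGraph {V ι : Type*} [Fintype V] (G : SimpleGraph V)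
    {k m : ℕ} (b : ι × Fin k → V) (hb : Function.Injective b) (W : Finset V)
    (hWb : ∀ v ∈ W, ∀ x, b x ≠ v) (hW : ∀ v ∈ W, ∃ i, ∀ j, G.Adj v (b (i, j)))
    (hm : 2 * k + 2 ≤ m) : W.card * k ≤ exNumber G (pathGraph m) := by
  rcases k.eq_zero_or_pos with rfl | hk
  · simp
  rcases W.eq_empty_or_nonempty with rfl | ⟨w₀, hw₀⟩
  · simp
  have : Nonempty ι := ⟨(hW w₀ hw₀).choose⟩
  choose! c hc using hW
  set H : SimpleGraph V := SimpleGraph.fromRel fun u v => u ∈ W ∧ ∃ j, b (c u, j) = v with hH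
  have hadj : ∀ u v, H.Adj u v → (u ∈ W ∧ ∃ j, b (c u, j) = v) ∨ (v ∈ W ∧ ∃ j, b (c v, j) = u) :=
    fun u v h => ((SimpleGraph.fromRel_adj _ _ _).1 h).2
  have hle : H ≤ G := by
    intro u v h
    rcases hadj u v h with ⟨hu, j, rfl⟩ | ⟨hv, j, rfl⟩
    · exact hc u hu j
    · exact (hc v hv j).symm
  -- A block vertex gets its block, a vertex of `W` the block chosen for it; the colour of the
  -- remaining, isolated vertices is irrelevant.
  set col : V → ι := fun v => if h : ∃ x, b x = v then h.choose.1 else c v with hcol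
  have hcolb : ∀ x, col (b x) = x.1 := fun x => by
    have h : ∃ y, b y = b x := ⟨x, rfl⟩
    simp only [hcol, dif_pos h]
    rw [hb h.choose_spec]
  have hcolW : ∀ v ∈ W, col v = c v := fun v hv => by
    simp only [hcol]
    rw [dif_neg]
    rintro ⟨x, hx⟩
    exact hWb v hv x hx
  have hfree : (pathGraph m).Free H := by
    refine pathGraph_free_of_cover (Finset.univ.filter fun v => ∃ x, b x = v) col ?_ ?_ (k := k)
      ?_ hm
    · intro u v h
      rcases hadj u v h with ⟨hu, j, rfl⟩ | ⟨hv, j, rfl⟩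
      · rw [hcolW u hu, hcolb]
      · rw [hcolW v hv, hcolb]
    · intro u v h
      rcases hadj u v h with ⟨hu, j, rfl⟩ | ⟨hv, j, rfl⟩
      · exact Or.inr (by simp)
      · exact Or.inl (by simp)
    · intro i
      refine (Finset.card_le_card (t := Finset.univ.image fun j : Fin k => b (i, j)) ?_).trans
        (Finset.card_image_le.trans (by simp))
      intro v hv
      simp only [Finset.mem_filter, Finset.mem_univ, true_and] at hv
      obtain ⟨⟨⟨i', j⟩, rfl⟩, h⟩ := hv
      rw [hcolb] at h
      exact Finset.mem_image.2 ⟨j, Finset.mem_univ _, by rw [← h]⟩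
  refine le_trans ?_ (card_edgeFinset_le_exNumber hle hfree)
  have hcard : W.card * k = (W ×ˢ (Finset.univ : Finset (Fin k))).card := by simp
  rw [hcard]
  refine Finset.card_le_card_of_injOn (fun x => s(x.1, b (c x.1, x.2))) ?_ ?_
  · rintro ⟨v, j⟩ hx
    have hv : v ∈ W := by simpa using hx
    simp only [Finset.mem_coe, mem_edgeFinset, mem_edgeSet, hH, SimpleGraph.fromRel_adj]
    exact ⟨(hWb v hv _).symm, Or.inl ⟨hv, j, rfl⟩⟩
  · rintro ⟨v, j⟩ hx ⟨v', j'⟩ hx' h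
    have hv : v ∈ W := by simpa using hx
    have hv' : v' ∈ W := by simpa using hx'
    simp only [Sym2.eq_iff] at h
    rcases h with ⟨rfl, h⟩ | ⟨h, -⟩
    · simpa using hb h
    · exact absurd h.symm (hWb v hv _)

end

/-! ### Independence, Chebyshev and the union bound in the binomial random graph -/

section
open scoped Classical

/-- The law of a random proposition that holds with probability `p`. -/
noncomputable def bernoulliProp (p : I) : Measure Prop :=
  toNNReal p • Measure.dirac True + toNNReal (σ p) • Measure.dirac False

theorem bernoulliProp_true (p : I) : bernoulliProp p {True} = toNNReal p := by
  simp [bernoulliProp]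

instance (p : I) : IsProbabilityMeasure (bernoulliProp p) := by
  refine ⟨?_⟩
  simp only [bernoulliProp, measure_univ]

theorem measurable_mem_edgeSet {V : Type*} (e : Sym2 V) :
    Measurable fun G : SimpleGraph V => e ∈ G.edgeSet :=
  (measurable_set_mem e).comp measurable_edgeSet

/-- Distinct pairs of vertices are edges of the binomial random graph independently with
probability `p`. -/
theorem map_mem_edgeSet_binomialRandom {V κ : Type*} [Countable V] (p : I) {e : κ → Sym2 V}
    (he : Function.Injective e) (hd : ∀ x, ¬ (e x).IsDiag) :
    (binomialRandom V p).map (fun G x => e x ∈ G.edgeSet) =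
      Measure.infinitePi fun _ => bernoulliProp p := by
  have hm : Measurable fun (G : SimpleGraph V) x => e x ∈ G.edgeSet :=
    measurable_pi_lambda _ fun x => measurable_mem_edgeSet (e x)
  have hof : Measurable fun q : Sym2 V → Prop => {i | q i} := measurable_set_iff.2 fun i =>
    measurable_pi_apply i
  rw [binomialRandom_eq_map, setBernoulli_eq_map, Measure.map_map measurable_fromEdgeSet hof,
    Measure.map_map hm (measurable_fromEdgeSet.comp hof)]
  -- `fromEdgeSet` discards only diagonal pairs, so on the pairs `e x` the map merely reindexes
  -- independent coordinates.
  have : ((fun (G : SimpleGraph V) x => e x ∈ G.edgeSet) ∘ fromEdgeSet ∘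
      fun q : Sym2 V → Prop => {i | q i}) = fun q x => q (e x) := by
    funext q x
    simp [hd]
  rw [this, Measure.map_infinitePi_infinitePi_of_inj he]
  congr 1
  funext x
  simp [bernoulliProp, hd]

theorem infinitePi_bernoulliProp_forall {κ : Type*} [Fintype κ] (p : I) :
    (Measure.infinitePi fun _ : κ => bernoulliProp p) {x | ∀ i, x i} =
      (toNNReal p : ENNReal) ^ Fintype.card κ := by
  have : {x : κ → Prop | ∀ i, x i} = {fun _ => True} := by
    ext x
    simp [funext_iff]
  rw [this, Measure.infinitePi_singleton_of_fintype]
  simp [bernoulliProp_true]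

/-- The probability that all pairs of `T` are edges is at most `p ^ T.card`. -/
theorem binomialRandom_forall_mem_le {V : Type*} [Countable V] (p : I) (T : Finset (Sym2 V)) :
    binomialRandom V p {G | ∀ e ∈ T, e ∈ G.edgeSet} ≤ (toNNReal p : ENNReal) ^ T.card := by
  by_cases hd : ∀ e ∈ T, ¬ e.IsDiag
  · have h := map_mem_edgeSet_binomialRandom (V := V) (κ := T) p Subtype.val_injective
      fun x => hd x.1 x.2
    have := infinitePi_bernoulliProp_forall (κ := T) p
    rw [← h, Measure.map_apply] at this
    · rw [Fintype.card_coe] at this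
      rw [← this]
      refine measure_mono fun G hG x => ?_
      exact hG x.1 x.2
    · exact measurable_pi_lambda _ fun x => measurable_mem_edgeSet x.1
    · exact (Set.toFinite _).measurableSet
  -- `T` may contain diagonal pairs, as `iteratePairs` does; then the event is empty.
  · push Not at hd
    obtain ⟨e, he, hed⟩ := hd
    have : {G : SimpleGraph V | ∀ e ∈ T, e ∈ G.edgeSet} = ∅ := by
      ext G
      simp only [Set.mem_ofPred_eq, Set.mem_empty_iff_false, iff_false]
      exact fun h => G.not_isDiag_of_mem_edgeSet (h e he) hed
    rw [this]
    simp

/-- Chebyshev's inequality for the number of successes of independent trials. -/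
theorem infinitePi_card_filter_lt_le {S Y : Type*} [Fintype S] [MeasurableSpace Y] (ν : Measure Y)
    [IsProbabilityMeasure ν] {A : Set Y} (hA : MeasurableSet A)
    (hpos : 0 < ν.real A * Fintype.card S) :
    (Measure.infinitePi fun _ : S => ν)
      {x | ((Finset.univ.filter fun s => x s ∈ A).card : ℝ) < ν.real A * Fintype.card S / 2} ≤
      ENNReal.ofReal (4 / (ν.real A * Fintype.card S)) := by
  set P := Measure.infinitePi fun _ : S => ν with hP
  set X : S → (S → Y) → ℝ := fun s x => A.indicator 1 (x s) with hX
  have hXm : ∀ s, Measurable (X s) := fun s =>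
    (measurable_one.indicator hA).comp (measurable_pi_apply s)
  have hXL : ∀ s, MemLp (X s) 2 P := fun s => by
    refine MemLp.of_bound (hXm s).aestronglyMeasurable 1 (ae_of_all _ fun x => ?_)
    by_cases h : x s ∈ A <;> simp [hX, h]
  have hE : ∀ s, ∫ x, X s x ∂P = ν.real A := fun s => by
    rw [← integral_indicator_one hA, ← Measure.infinitePi_map_eval (fun _ : S => ν) s,
      integral_map (measurable_pi_apply s).aemeasurable
        (measurable_one.indicator hA).aestronglyMeasurable]
  have hV : ∀ s, variance (X s) P ≤ ν.real A := fun s => by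
    refine (variance_le_expectation_sq (hXm s).aestronglyMeasurable).trans ?_
    rw [← hE s]
    refine le_of_eq (integral_congr_ae (ae_of_all _ fun x => ?_))
    by_cases h : x s ∈ A <;> simp [hX, h]
  have hind : iIndepFun X P := iIndepFun_infinitePi (X := fun _ => A.indicator (1 : Y → ℝ))
    fun _ => measurable_one.indicator hA
  have hVs : variance (∑ s, X s) P ≤ ν.real A * Fintype.card S := by
    rw [IndepFun.variance_sum (fun s _ => hXL s) fun s _ t _ hst => hind.indepFun hst]
    refine (Finset.sum_le_sum fun s _ => hV s).trans_eq ?_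
    simp [mul_comm]
  have hEs : ∫ x, (∑ s, X s) x ∂P = ν.real A * Fintype.card S := by
    simp only [Finset.sum_apply]
    rw [integral_finsetSum _ fun s _ => (hXL s).integrable (by norm_num)]
    simp [hE, mul_comm]
  have hcount : ∀ x, (∑ s, X s) x = ((Finset.univ.filter fun s => x s ∈ A).card : ℝ) := fun x => by
    simp [hX, Set.indicator_apply, Finset.sum_apply]
  set M := ν.real A * Fintype.card S with hM
  -- The variance is at most the mean `M`, so a deviation of `M / 2` has probability at most `M / (M
  -- / 2) ^ 2 = 4 / M`.
  have hcheb := meas_ge_le_variance_div_sq (μ := P) (memLp_finsetSum' Finset.univ fun s _ => hXL s)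
    (c := M / 2) (by positivity)
  rw [hEs] at hcheb
  refine (measure_mono fun x hx => ?_).trans (hcheb.trans (ENNReal.ofReal_le_ofReal ?_))
  · simp only [Set.mem_ofPred_eq] at hx ⊢
    rw [hcount, abs_sub_comm]
    exact le_trans (by linarith) (le_abs_self _)
  · rw [div_le_div_iff₀ (by positivity) hpos]
    nlinarith

/-- The complement asks every one of the independent blocks to fail, each with probability `1 - p ^
k`. -/
theorem infinitePi_bernoulliProp_exists_forall {ι : Type*} [Fintype ι] (p : I) (k : ℕ) :
    (Measure.infinitePi fun _ : ι => Measure.infinitePi fun _ : Fin k => bernoulliProp p).real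
      {x | ∃ i, ∀ j, x i j} = 1 - (1 - (p : ℝ) ^ k) ^ Fintype.card ι := by
  set ν := Measure.infinitePi fun _ : Fin k => bernoulliProp p with hν
  have hB : MeasurableSet {y : Fin k → Prop | ∀ j, y j} := (Set.toFinite _).measurableSet
  have hBν : ν.real {y : Fin k → Prop | ∀ j, y j} = (p : ℝ) ^ k := by
    rw [Measure.real, hν, infinitePi_bernoulliProp_forall]
    simp
  have h1 : {x : ι → Fin k → Prop | ∃ i, ∀ j, x i j} =
      (Set.univ.pi fun _ : ι => {y : Fin k → Prop | ∀ j, y j}ᶜ)ᶜ := by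
    ext x
    simp
  rw [h1, probReal_compl_eq_one_sub (.univ_pi fun _ => hB.compl), Measure.real,
    Measure.infinitePi_pi_univ (fun _ => ν) (fun _ => hB.compl)]
  simp only [ENNReal.toReal_prod, tprod_fintype]
  rw [Finset.prod_const, ← Measure.real, probReal_compl_eq_one_sub hB, hBν, Finset.card_univ]

/-- Lower tail of `ex(G, P_m)` in the binomial random graph, obtained from stars over disjoint
blocks of `k` vertices. -/
theorem binomialRandom_exNumber_lt_le {V ι : Type*} [Fintype V] [Fintype ι] (p : I) {k m : ℕ}
    (b : ι × Fin k → V) (hb : Function.Injective b) (hm : 2 * k + 2 ≤ m) {q s : ℝ}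
    (hq : q = 1 - (1 - (p : ℝ) ^ k) ^ Fintype.card ι)
    (hs : s = Fintype.card V - Fintype.card ι * k) (hpos : 0 < q * s) :
    binomialRandom V p {G | (exNumber G (pathGraph m) : ℝ) < q * s / 2 * k} ≤
      ENNReal.ofReal (4 / (q * s)) := by
  set S := {v : V // v ∉ Set.range b} with hS
  have hcard : (Fintype.card S : ℝ) = s := by
    rw [Fintype.card_subtype_compl, hs, Nat.cast_sub (Fintype.card_subtype_le _)]
    have : Fintype.card {v // v ∈ Set.range b} = Fintype.card ι * k := by
      rw [show Fintype.card ι * k = Fintype.card (ι × Fin k) by simp]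
      exact Set.card_range_of_injective hb
    rw [this]
    push_cast
    rfl
  -- Exactly one end of each such pair lies outside the blocks, so the pairs are distinct. Currying
  -- their joint law makes the outside vertices independent trials.
  set e : S × ι × Fin k → Sym2 V := fun x => s(x.1.1, b x.2) with he
  have hei : Function.Injective e := by
    rintro ⟨⟨v, hv⟩, x⟩ ⟨⟨v', hv'⟩, x'⟩ h
    simp only [he, Sym2.eq_iff] at h
    rcases h with ⟨rfl, h⟩ | ⟨h, -⟩
    · simp [hb h]
    · exact absurd ⟨x', h.symm⟩ hv
  have hed : ∀ x, ¬ (e x).IsDiag := by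
    rintro ⟨⟨v, hv⟩, x⟩ h
    simp only [he, Sym2.mk_isDiag_iff] at h
    exact hv ⟨x, h.symm⟩
  set A : Set (ι → Fin k → Prop) := {x | ∃ i, ∀ j, x i j} with hA
  have hAm : MeasurableSet A := (Set.toFinite _).measurableSet
  set ν := Measure.infinitePi fun _ : ι => Measure.infinitePi fun _ : Fin k => bernoulliProp p
    with hν
  have hνA : ν.real A = q := by rw [hq, ← infinitePi_bernoulliProp_exists_forall]
  have hmeas : Measurable fun (G : SimpleGraph V) (v : S) i j => e (v, i, j) ∈ G.edgeSet :=
    measurable_pi_lambda _ fun v => measurable_pi_lambda _ fun i => measurable_pi_lambda _ fun j =>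
      measurable_mem_edgeSet _
  have hlaw : (binomialRandom V p).map (fun G (v : S) i j => e (v, i, j) ∈ G.edgeSet) =
      Measure.infinitePi fun _ : S => ν := by
    have h1 := map_mem_edgeSet_binomialRandom p hei hed
    have hm1 : Measurable fun (G : SimpleGraph V) x => e x ∈ G.edgeSet :=
      measurable_pi_lambda _ fun x => measurable_mem_edgeSet (e x)
    have hm2 : Measurable fun (x : S × ι × Fin k → Prop) (v : S) (y : ι × Fin k) => x (v, y) :=
      (MeasurableEquiv.curry S (ι × Fin k) Prop).measurable
    have hm3 : Measurable fun (x : ι × Fin k → Prop) (i : ι) (j : Fin k) => x (i, j) :=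
      (MeasurableEquiv.curry ι (Fin k) Prop).measurable
    have h2 : Measure.map (fun x v y => x (v, y))
        (Measure.infinitePi fun _ : S × ι × Fin k => bernoulliProp p) = _ :=
      Measure.infinitePi_map_curry fun (_ : S) (_ : ι × Fin k) => bernoulliProp p
    have h3 : Measure.map (fun x i j => x (i, j))
        (Measure.infinitePi fun _ : ι × Fin k => bernoulliProp p) = ν :=
      Measure.infinitePi_map_curry fun (_ : ι) (_ : Fin k) => bernoulliProp p
    have h4 := Measure.infinitePi_map_pi (fun _ : S => Measure.infinitePi fun _ : ι × Fin k =>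
      bernoulliProp p) (fun _ : S => hm3)
    have hm4 : Measurable fun (x : S → ι × Fin k → Prop) (v : S) i j => x v (i, j) :=
      measurable_pi_lambda _ fun v => hm3.comp (measurable_pi_apply v)
    simp only [h3] at h4
    rw [← h4, ← h2, ← h1, Measure.map_map hm2 hm1, Measure.map_map hm4 (hm2.comp hm1)]
    rfl
  have hcheb := infinitePi_card_filter_lt_le (S := S) ν hAm (by rwa [hνA, hcard])
  rw [← hlaw, hνA, hcard, Measure.map_apply] at hcheb
  · refine (measure_mono fun G hG => ?_).trans hcheb
    simp only [Set.mem_ofPred_eq, Set.mem_preimage] at hG ⊢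
    by_contra! hcon
    set W := (Finset.univ.filter fun v : S => (fun i j => e (v, i, j) ∈ G.edgeSet) ∈ A) with hW
    have := card_mul_le_exNumber_pathGraph G b hb (W.map (Function.Embedding.subtype _)) ?_ ?_ hm
    · rw [Finset.card_map] at this
      have h' : (W.card : ℝ) * k ≤ exNumber G (pathGraph m) := by exact_mod_cast this
      have := mul_le_mul_of_nonneg_right hcon (Nat.cast_nonneg (α := ℝ) k)
      linarith
    · intro v hv x hx
      obtain ⟨w, -, rfl⟩ := Finset.mem_map.1 hv
      exact w.2 ⟨x, hx⟩
    · intro v hv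
      obtain ⟨w, hw, rfl⟩ := Finset.mem_map.1 hv
      obtain ⟨i, hi⟩ := (Finset.mem_filter.1 hw).2
      exact ⟨i, fun j => hi j⟩
  · exact hmeas
  · exact (Set.toFinite _).measurableSet

/-- Upper tail of `ex(G, P_{n+1})` in the binomial random graph, by a union bound over
depth-first search forests. -/
theorem binomialRandom_lt_exNumber_le {V : Type*} [Fintype V] (p : I) (n m : ℕ) :
    binomialRandom V p {G | m < exNumber G (pathGraph (n + 1))} ≤
      ((Fintype.card V : ENNReal) ^ Fintype.card V) *
        ((n * Fintype.card V).choose (m + 1) * (toNNReal p : ENNReal) ^ (m + 1)) := by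
  have hsub : {G : SimpleGraph V | m < exNumber G (pathGraph (n + 1))} ⊆
      ⋃ f ∈ (Finset.univ : Finset (V → V)), ⋃ T ∈ (iteratePairs f n).powersetCard (m + 1),
        {G | ∀ e ∈ T, e ∈ G.edgeSet} := by
    intro G hG
    obtain ⟨f, T, hT, h⟩ := exists_subset_iteratePairs_of_lt_exNumber hG
    simp only [Set.mem_iUnion]
    exact ⟨f, Finset.mem_univ _, T, hT, h⟩
  refine (measure_mono hsub).trans ((measure_biUnion_finset_le _ _).trans ?_)
  have hf : ∀ f : V → V, binomialRandom V p (⋃ T ∈ (iteratePairs f n).powersetCard (m + 1),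
      {G | ∀ e ∈ T, e ∈ G.edgeSet}) ≤
      (n * Fintype.card V).choose (m + 1) * (toNNReal p : ENNReal) ^ (m + 1) := by
    intro f
    refine (measure_biUnion_finset_le _ _).trans ?_
    refine (Finset.sum_le_card_nsmul _ _ ((toNNReal p : ENNReal) ^ (m + 1)) fun T hT => ?_).trans ?_
    · have := binomialRandom_forall_mem_le p T
      rwa [(Finset.mem_powersetCard.1 hT).2] at this
    · rw [Finset.card_powersetCard, nsmul_eq_mul]
      gcongr
      exact card_iteratePairs_le f n
  refine (Finset.sum_le_card_nsmul _ _ _ fun f _ => hf f).trans_eq ?_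
  rw [nsmul_eq_mul, Finset.card_univ, Fintype.card_fun]
  push_cast
  rfl

end

/-! ### Estimates for the upper tail -/

/-- Combine `a.choose r ≤ a ^ r / r!` with `r ^ r / r! ≤ e ^ r`. -/
theorem choose_mul_pow_le (a r : ℕ) {p : ℝ} (hp : 0 ≤ p) (hr : 0 < r) :
    (a.choose r : ℝ) * p ^ r ≤ (Real.exp 1 * a * p / r) ^ r := by
  have hr' : (0 : ℝ) < r := by exact_mod_cast hr
  have h1 : (a.choose r : ℝ) ≤ (a : ℝ) ^ r / r.factorial := Nat.choose_le_pow_div r a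
  have h2 := Real.pow_div_factorial_le_exp (r : ℝ) hr'.le r
  have hf : (0 : ℝ) < r.factorial := by exact_mod_cast r.factorial_pos
  have hexp : Real.exp r = Real.exp 1 ^ r := by rw [← Real.exp_nat_mul, mul_one]
  rw [hexp, div_le_iff₀ hf] at h2
  calc (a.choose r : ℝ) * p ^ r ≤ (a : ℝ) ^ r / r.factorial * p ^ r := by gcongr
    _ ≤ (Real.exp 1 * a * p / r) ^ r := by
      rw [div_mul_eq_mul_div, div_pow, div_le_div_iff₀ hf (by positivity), mul_pow, mul_pow]
      have : 0 ≤ (a : ℝ) ^ r * p ^ r := by positivity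
      nlinarith [mul_le_mul_of_nonneg_left h2 this]

/-- The estimate behind the union bound over depth-first search forests. -/
theorem pow_mul_choose_mul_pow_le {N n r : ℕ} {p ω : ℝ} (hN : 1 ≤ N) (hn : 1 ≤ n) (hp : 0 < p)
    (hω : ω = Real.log N / (n * p)) (hω1 : 1 < ω)
    (hr : 8 * (ω / Real.log ω) * p * n * N ≤ r) :
    (N : ℝ) ^ N * (((n * N).choose r : ℝ) * p ^ r) ≤ Real.exp (-(3 * Real.log N * N)) := by
  have hN' : (0 : ℝ) < N := by exact_mod_cast hN
  have hn' : (0 : ℝ) < n := by exact_mod_cast hn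
  have hy : 0 < Real.log ω := Real.log_pos hω1
  have hω0 : 0 < ω := by linarith
  set y := Real.log ω with hydef
  set B := 8 * (ω / y) * p * n * N with hB
  have hBpos : 0 < B := by positivity
  have hrpos : (0 : ℝ) < r := hBpos.trans_le hr
  have hLω : ω * p * n = Real.log N := by rw [hω]; field_simp
  have hBy : B * y = 8 * Real.log N * N := by
    rw [← hLω, hB]; field_simp
  have h1 := choose_mul_pow_le (n * N) r hp.le (by exact_mod_cast hrpos)
  -- With `B` in place of `r` the quotient is `(e y / 8) / ω`, where `ω = exp y` and `e y / 8 ≤ 1 +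
  -- y / 2 ≤ exp (y / 2)`. The power `r ≥ B` then yields `exp (-B y / 2) = exp (-4 N log N)`.
  have h2 : Real.exp 1 * (n * N : ℕ) * p / r ≤ Real.exp (-(y / 2)) := by
    calc Real.exp 1 * (n * N : ℕ) * p / r ≤ Real.exp 1 * (n * N : ℕ) * p / B := by gcongr
      _ = Real.exp 1 * y / 8 / Real.exp y := by
        rw [hB, hydef, Real.exp_log hω0]; push_cast; field_simp
      _ ≤ Real.exp (y / 2) / Real.exp y := by
        gcongr
        have := Real.add_one_le_exp (y / 2)
        have := Real.exp_one_lt_d9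
        nlinarith
      _ = Real.exp (-(y / 2)) := by rw [← Real.exp_sub]; congr 1; ring
  have h3 : ((n * N).choose r : ℝ) * p ^ r ≤ Real.exp (-(4 * Real.log N * N)) := by
    refine h1.trans ((pow_le_pow_left₀ (by positivity) h2 r).trans ?_)
    rw [← Real.exp_nat_mul, Real.exp_le_exp]
    nlinarith [mul_le_mul_of_nonneg_right hr hy.le]
  have h4 : (N : ℝ) ^ N = Real.exp (Real.log N * N) := by
    rw [mul_comm, Real.exp_nat_mul, Real.exp_log hN']
  rw [h4]
  calc _ ≤ Real.exp (Real.log N * N) * Real.exp (-(4 * Real.log N * N)) := by gcongr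
    _ = _ := by rw [← Real.exp_add]; congr 1; ring

theorem two_mul_le_log {N n : ℕ} (hn : 1 ≤ n) (hN : (n : ℝ) * Real.exp (2 * n) ≤ N) :
    2 * (n : ℝ) ≤ Real.log N := by
  have hn' : (1 : ℝ) ≤ n := by exact_mod_cast hn
  have h : Real.exp (2 * n) ≤ N := le_trans (by nlinarith [Real.exp_pos (2 * n)]) hN
  rw [Real.le_log_iff_exp_le (lt_of_lt_of_le (Real.exp_pos _) h)]
  exact h

theorem le_of_mul_exp_le {N n : ℕ} (hN : (n : ℝ) * Real.exp (2 * n) ≤ N) : n ≤ N := by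
  have h1 : (1 : ℝ) ≤ Real.exp (2 * n) := Real.one_le_exp (by positivity)
  have : (n : ℝ) ≤ N := le_trans (by nlinarith [Nat.cast_nonneg (α := ℝ) n]) hN
  exact_mod_cast this

theorem binomialRandom_upper_tail_le {N n : ℕ} {p : I} {ω : ℝ} (hn : 1 ≤ n)
    (hN : (n : ℝ) * Real.exp (2 * n) ≤ N) (hp : 0 < (p : ℝ))
    (hω : ω = Real.log N / (n * p)) :
    binomialRandom (Fin N) p {G | 8 * (ω / Real.log ω) * p * n * N <
      (exNumber G (pathGraph (n + 1)) : ℝ)} ≤ ENNReal.ofReal (1 / n) := by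
  have hn' : (1 : ℝ) ≤ n := by exact_mod_cast hn
  have hnN := le_of_mul_exp_le hN
  have hL := two_mul_le_log hn hN
  -- This uses `log N ≥ 2n > np`.
  have hω1 : 1 < ω := by
    rw [hω, lt_div_iff₀ (by positivity)]
    have : (p : ℝ) ≤ 1 := p.2.2
    nlinarith
  have hω0 := Real.log_pos hω1
  set B := 8 * (ω / Real.log ω) * p * n * N with hB
  have hB0 : 0 ≤ B := by positivity
  have hsub : {G : SimpleGraph (Fin N) | B < (exNumber G (pathGraph (n + 1)) : ℝ)} ⊆
      {G | ⌊B⌋₊ < exNumber G (pathGraph (n + 1))} := fun G hG => (Nat.floor_lt hB0).2 hG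
  refine (measure_mono hsub).trans ((binomialRandom_lt_exNumber_le p n ⌊B⌋₊).trans ?_)
  have h1 := pow_mul_choose_mul_pow_le (r := ⌊B⌋₊ + 1) (hn.trans hnN) hn hp hω hω1
    (by push_cast; exact (Nat.lt_floor_add_one B).le)
  have h2 : Real.exp (-(3 * Real.log N * N)) ≤ 1 / n := by
    have hNn : (n : ℝ) ≤ N := by exact_mod_cast hnN
    rw [Real.exp_neg, ← one_div]
    refine one_div_le_one_div_of_le (by linarith) ?_
    have := Real.add_one_le_exp (3 * Real.log N * N)
    nlinarith
  refine le_trans (le_of_eq ?_) (ENNReal.ofReal_le_ofReal (h1.trans h2))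
  have hpe : (toNNReal p : ENNReal) = ENNReal.ofReal p := by
    rw [ENNReal.ofReal, Real.toNNReal_of_nonneg p.2.1]
    rfl
  rw [Fintype.card_fin, hpe, ENNReal.ofReal_mul (by positivity), ENNReal.ofReal_mul (by positivity),
    ENNReal.ofReal_pow hp.le, ENNReal.ofReal_pow (by positivity), ENNReal.ofReal_natCast,
    ENNReal.ofReal_natCast]

/-! ### Lower tails in the two ranges of `p` -/

/-- A lower tail estimate from about `N / (2 * k)` disjoint blocks of `k` vertices. -/
theorem binomialRandom_lower_tail_le {N n k : ℕ} {p : I} {q B : ℝ} (hkn : 2 * k + 1 ≤ n)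
    (hN : 0 < N) (hq0 : 0 < q) (hq : Real.exp (-((N / (2 * k) : ℕ) * (p : ℝ) ^ k)) ≤ 1 - q)
    (hB : B ≤ q * N / 4 * k) :
    binomialRandom (Fin N) p {G | (exNumber G (pathGraph (n + 1)) : ℝ) < B} ≤
      ENNReal.ofReal (8 / (q * N)) := by
  set M := N / (2 * k) with hM
  have hMk : 2 * (M * k) ≤ N := by
    have := Nat.div_mul_le_self N (2 * k)
    rw [← hM] at this
    nlinarith
  have hMk' : M * k ≤ N := by omega
  set b : Fin M × Fin k → Fin N := fun x => Fin.castLE hMk' (finProdFinEquiv x) with hb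
  have hbi : Function.Injective b := (Fin.castLE_injective hMk').comp finProdFinEquiv.injective
  have hp1 : (p : ℝ) ^ k ≤ 1 := pow_le_one₀ p.2.1 p.2.2
  have hN' : (0 : ℝ) < N := by exact_mod_cast hN
  have hq' : q ≤ 1 - (1 - (p : ℝ) ^ k) ^ Fintype.card (Fin M) := by
    rw [Fintype.card_fin]
    have h1 : (1 - (p : ℝ) ^ k) ^ M ≤ Real.exp (-(M * (p : ℝ) ^ k)) := by
      have := pow_le_pow_left₀ (by linarith) (Real.one_sub_le_exp_neg ((p : ℝ) ^ k)) M
      rwa [← Real.exp_nat_mul, mul_neg] at this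
    linarith
  have hs : (N : ℝ) / 2 ≤ (Fintype.card (Fin N) : ℝ) - Fintype.card (Fin M) * k := by
    have : (2 * (M * k) : ℝ) ≤ N := by exact_mod_cast hMk
    simp only [Fintype.card_fin]
    linarith
  have hqs : q * (N / 2) ≤ (1 - (1 - (p : ℝ) ^ k) ^ Fintype.card (Fin M)) *
      ((Fintype.card (Fin N) : ℝ) - Fintype.card (Fin M) * k) :=
    mul_le_mul hq' hs (by positivity) (hq0.le.trans hq')
  have hqpos : 0 < q * (N / 2) := by positivity
  refine le_trans (measure_mono ?_) ((binomialRandom_exNumber_lt_le p b hbi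
    (m := n + 1) (by omega) rfl rfl (hqpos.trans_le hqs)).trans (ENNReal.ofReal_le_ofReal ?_))
  · intro G hG
    refine lt_of_lt_of_le hG (hB.trans ?_)
    have := mul_le_mul_of_nonneg_right hqs (Nat.cast_nonneg (α := ℝ) k)
    linarith
  · refine (div_le_div_of_nonneg_left (by norm_num) hqpos hqs).trans_eq ?_
    field_simp
    norm_num

/-- There are at least `N / (2n)` blocks and `p ^ k ≥ N ^ (-1/6)`, so the product is at least `N ^
(5/6) / (2n)`, and `N ^ (5/6) ≥ exp n ≥ 4n`. -/
theorem two_le_div_mul_pow {N n k : ℕ} {p : I} (hn : 12 ≤ n)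
    (hN : (n : ℝ) * Real.exp (2 * n) ≤ N) (hk : 0 < k) (hkn : 2 * k + 1 ≤ n)
    (hp : Real.exp (-(Real.log N / 6)) ≤ (p : ℝ) ^ k) :
    2 ≤ ((N / (2 * k) : ℕ) : ℝ) * (p : ℝ) ^ k := by
  have hnN := le_of_mul_exp_le hN
  have hL := two_mul_le_log (by omega) hN
  have hN' : (0 : ℝ) < N := by exact_mod_cast (show 0 < N by omega)
  have hn' : (12 : ℝ) ≤ n := by exact_mod_cast hn
  set M := N / (2 * k) with hM
  have hM1 : 1 ≤ M := (Nat.one_le_div_iff (by omega)).2 (by omega)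
  have hlt : N < 2 * k * (M + 1) := Nat.lt_mul_div_succ N (by omega)
  have h4 : N ≤ 2 * n * M := by nlinarith
  have h4' : (N : ℝ) ≤ 2 * n * M := by exact_mod_cast h4
  have hexp : Real.exp (-(Real.log N / 6)) * N = Real.exp (5 / 6 * Real.log N) := by
    nth_rewrite 2 [← Real.exp_log hN']
    rw [← Real.exp_add]; congr 1; ring
  have hbig : 4 * (n : ℝ) ≤ Real.exp (5 / 6 * Real.log N) := by
    have h1 : Real.exp n ≤ Real.exp (5 / 6 * Real.log N) := Real.exp_le_exp.2 (by linarith)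
    have h2 := Real.quadratic_le_exp_of_nonneg (x := (n : ℝ)) (by linarith)
    nlinarith
  have h5 : Real.exp (-(Real.log N / 6)) * N ≤ (p : ℝ) ^ k * (2 * n * M) :=
    mul_le_mul hp h4' hN'.le (pow_nonneg p.2.1 k)
  have h6 : 2 * n * 2 ≤ 2 * n * (M * (p : ℝ) ^ k) := by linarith
  exact le_of_mul_le_mul_left h6 (by linarith)

theorem binomialRandom_lower_tail_le_of_exp_le {N n k : ℕ} {p : I} {B : ℝ} (hn : 12 ≤ n)
    (hN : (n : ℝ) * Real.exp (2 * n) ≤ N) (hk : 0 < k) (hkn : 2 * k + 1 ≤ n)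
    (hp : Real.exp (-(Real.log N / 6)) ≤ (p : ℝ) ^ k) (hB : B ≤ N / 5 * k) :
    binomialRandom (Fin N) p {G | (exNumber G (pathGraph (n + 1)) : ℝ) < B} ≤
      ENNReal.ofReal (24 / n) := by
  have hnN := le_of_mul_exp_le hN
  have h2 := two_le_div_mul_pow hn hN hk hkn hp
  have hn' : (12 : ℝ) ≤ n := by exact_mod_cast hn
  have hNn : (n : ℝ) ≤ N := by exact_mod_cast hnN
  -- The value `4 / 5` comes from `exp 2 ≥ 1 + 2 + 2 = 5`.
  refine (binomialRandom_lower_tail_le (q := 4 / 5) hkn (by omega) (by norm_num) ?_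
    (hB.trans_eq (by ring))).trans (ENNReal.ofReal_le_ofReal ?_)
  · refine (Real.exp_le_exp.2 (neg_le_neg h2)).trans ?_
    have h3 := Real.quadratic_le_exp_of_nonneg (x := 2) (by norm_num)
    rw [Real.exp_neg, ← one_div]
    refine (one_div_le_one_div_of_le (by norm_num) h3).trans (by norm_num)
  · rw [div_le_div_iff₀ (by linarith) (by linarith)]
    linarith

/-- Single-vertex blocks serve the sparsest range: about `N / 2` centres at `p ≥ 1 / N` reach an
outside vertex with probability at least `7 / 20`, and `7 / 80 ≥ 2 / 25`. -/
theorem binomialRandom_lower_tail_le_of_inv_le {N n : ℕ} {p : I} {B : ℝ} (hn : 12 ≤ n)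
    (hnN : n ≤ N) (hp : (N : ℝ)⁻¹ ≤ p) (hB : B ≤ 2 / 25 * N) :
    binomialRandom (Fin N) p {G | (exNumber G (pathGraph (n + 1)) : ℝ) < B} ≤
      ENNReal.ofReal (24 / n) := by
  have hn' : (12 : ℝ) ≤ n := by exact_mod_cast hn
  have hNn : (n : ℝ) ≤ N := by exact_mod_cast hnN
  refine (binomialRandom_lower_tail_le (q := 7 / 20) (k := 1) (by omega) (by omega) (by norm_num)
    ?_ (hB.trans ?_)).trans (ENNReal.ofReal_le_ofReal ?_)
  · have h1 : (N : ℝ) ≤ 2 * (N / (2 * 1) : ℕ) + 1 := by exact_mod_cast (by omega)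
    have h2 : 9 / 20 ≤ ((N / (2 * 1) : ℕ) : ℝ) * (p : ℝ) ^ 1 := by
      rw [pow_one]
      refine le_trans ?_ (mul_le_mul_of_nonneg_left hp (by positivity))
      rw [← div_eq_mul_inv, le_div_iff₀ (by linarith)]
      linarith
    refine (Real.exp_le_exp.2 (neg_le_neg h2)).trans ?_
    have h3 := Real.quadratic_le_exp_of_nonneg (x := 9 / 20) (by norm_num)
    rw [Real.exp_neg, ← one_div]
    refine (one_div_le_one_div_of_le (by norm_num) h3).trans (by norm_num)
  · push_cast
    linarith
  · rw [div_le_div_iff₀ (by linarith) (by linarith)]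
    linarith

/-! ### Assembling the tails -/

theorem exNumber_pathGraph_le_half {N n : ℕ} (hn : 1 ≤ n) (G : SimpleGraph (Fin N)) :
    (exNumber G (pathGraph (n + 1)) : ℝ) ≤ 1 / 2 * n * N := by
  obtain ⟨n, rfl⟩ := Nat.exists_eq_add_of_le' hn
  have h : (2 * exNumber G (pathGraph (n + 2)) : ℝ) ≤ n * N := by
    exact_mod_cast (two_mul_exNumber_pathGraph_le G n).trans_eq (by rw [Fintype.card_fin])
  push_cast
  nlinarith [Nat.cast_nonneg (α := ℝ) N]

/-- If both tails tend to zero, the probability of lying in between tends to one. -/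
theorem tendsto_exPathBetween_of_tails {N : ℕ → ℕ} {p : ℕ → I} {a b : ℕ → ℝ} {C D : ℝ}
    (ha : ∀ᶠ n : ℕ in atTop, binomialRandom (Fin (N n)) (p n)
      {G | (exNumber G (pathGraph (n + 1)) : ℝ) < a n} ≤ ENNReal.ofReal (C / n))
    (hb : ∀ᶠ n : ℕ in atTop, binomialRandom (Fin (N n)) (p n)
      {G | b n < (exNumber G (pathGraph (n + 1)) : ℝ)} ≤ ENNReal.ofReal (D / n)) :
    Tendsto (fun n : ℕ => binomialRandom (Fin (N n)) (p n)
      (exPathBetween (N n) (n + 1) (a n) (b n))) atTop (𝓝 1) := by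
  have hlim : ∀ c : ℝ, Tendsto (fun n : ℕ => ENNReal.ofReal (c / n)) atTop (𝓝 0) := fun c => by
    simpa using ENNReal.tendsto_ofReal (tendsto_const_div_atTop_nhds_zero_nat c)
  have hlow : Tendsto (fun n : ℕ => 1 - (ENNReal.ofReal (C / n) + ENNReal.ofReal (D / n))) atTop
      (𝓝 1) := by
    have := ENNReal.Tendsto.sub (tendsto_const_nhds (x := (1 : ENNReal)) (f := atTop))
      ((hlim C).add (hlim D)) (Or.inl ENNReal.one_ne_top)
    simpa using this
  refine tendsto_of_tendsto_of_tendsto_of_le_of_le' hlow tendsto_const_nhds ?_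
    (Eventually.of_forall fun n => prob_le_one)
  filter_upwards [ha, hb] with n ha hb
  rw [tsub_le_iff_right]
  have hsub : (Set.univ : Set (SimpleGraph (Fin (N n)))) ⊆
      exPathBetween (N n) (n + 1) (a n) (b n) ∪
        ({G | (exNumber G (pathGraph (n + 1)) : ℝ) < a n} ∪
          {G | b n < (exNumber G (pathGraph (n + 1)) : ℝ)}) := by
    intro G _
    by_cases h1 : (exNumber G (pathGraph (n + 1)) : ℝ) < a n
    · exact Or.inr (Or.inl h1)
    by_cases h2 : b n < (exNumber G (pathGraph (n + 1)) : ℝ)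
    · exact Or.inr (Or.inr h2)
    · exact Or.inl ⟨not_lt.1 h1, not_lt.1 h2⟩
  calc (1 : ENNReal) = binomialRandom (Fin (N n)) (p n) Set.univ := measure_univ.symm
    _ ≤ _ := (measure_mono hsub).trans (measure_union_le _ _)
    _ ≤ _ := by
      gcongr
      exact (measure_union_le _ _).trans (add_le_add ha hb)

theorem binomialRandom_lower_tail_dense {N n : ℕ} {p : I} (hn : 12 ≤ n)
    (hN : (n : ℝ) * Real.exp (2 * n) ≤ N) (hp : (N : ℝ) ^ (-(2 / (5 * n)) : ℝ) ≤ p) :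
    binomialRandom (Fin N) p {G | (exNumber G (pathGraph (n + 1)) : ℝ) < 1 / 16 * n * N} ≤
      ENNReal.ofReal (24 / n) := by
  have hnN := le_of_mul_exp_le hN
  have hL := two_mul_le_log (by omega) hN
  have hn' : (12 : ℝ) ≤ n := by exact_mod_cast hn
  have hN' : (0 : ℝ) < N := by exact_mod_cast (show 0 < N by omega)
  -- The largest `k` with `k * (2 / (5n)) ≤ 1 / 6`, so that `p ^ k ≥ N ^ (-1/6)`; rounding still
  -- leaves `k / 5 ≥ n / 16` once `n ≥ 12`.
  obtain ⟨k, hk⟩ : ∃ k, k = 5 * n / 12 := ⟨_, rfl⟩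
  have hk1 : (12 * k : ℝ) ≤ 5 * n := by exact_mod_cast (show 12 * k ≤ 5 * n by omega)
  have hk2 : (n : ℝ) * 5 ≤ 16 * k := by exact_mod_cast (show n * 5 ≤ 16 * k by omega)
  refine binomialRandom_lower_tail_le_of_exp_le (k := k) hn hN (by omega) (by omega) ?_ ?_
  · rw [Real.rpow_def_of_pos hN'] at hp
    refine le_trans ?_ (pow_le_pow_left₀ (Real.exp_pos _).le hp k)
    rw [← Real.exp_nat_mul, Real.exp_le_exp]
    have : (k : ℝ) * (Real.log N * -(2 / (5 * n))) = -(Real.log N * (2 * k / (5 * n))) := by ring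
    rw [this, neg_le_neg_iff, div_eq_mul_inv (Real.log N)]
    refine mul_le_mul_of_nonneg_left ?_ (by linarith)
    rw [div_le_iff₀ (by linarith)]
    linarith
  · nlinarith

theorem binomialRandom_lower_tail_sparse {N n : ℕ} {p : I} {ω : ℝ} (hn : 12 ≤ n)
    (hN : (n : ℝ) * Real.exp (2 * n) ≤ N) (hω : ω = Real.log N / (n * p))
    (hp₁ : (N : ℝ)⁻¹ ≤ p) (hp₂ : (p : ℝ) ≤ (N : ℝ) ^ (-(2 / (5 * n)) : ℝ)) :
    binomialRandom (Fin N) p {G | (exNumber G (pathGraph (n + 1)) : ℝ) <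
      1 / 75 * (ω / Real.log ω) * p * n * N} ≤ ENNReal.ofReal (24 / n) := by
  have hnN := le_of_mul_exp_le hN
  have hL := two_mul_le_log (by omega) hN
  have hn' : (12 : ℝ) ≤ n := by exact_mod_cast hn
  have hN' : (0 : ℝ) < N := by exact_mod_cast (show 0 < N by omega)
  have hp : 0 < (p : ℝ) := (inv_pos.2 hN').trans_le hp₁
  set L := Real.log N with hLdef
  set ℓ := -Real.log p with hℓ
  have hℓL : 2 * L / (5 * n) ≤ ℓ := by
    have := Real.log_le_log hp hp₂
    rw [Real.log_rpow hN'] at this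
    rw [hℓ]
    have h2 : 2 * L / (5 * n) = 2 / (5 * n) * L := by ring
    linarith
  have hℓ0 : 0 < ℓ := lt_of_lt_of_le (by apply div_pos <;> linarith) hℓL
  have hωℓ : ℓ ≤ Real.log ω := by
    rw [hℓ, ← Real.log_inv]
    refine Real.log_le_log (inv_pos.2 hp) ?_
    rw [hω, inv_eq_one_div, div_le_div_iff₀ hp (by positivity)]
    nlinarith
  -- `p ^ k ≥ N ^ (-1/6)` means `k ≤ X / 6`. The upper bound on `p` gives `X ≤ 5n / 2`, which keeps
  -- `2 * k + 1 ≤ n`.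
  set X := L / ℓ with hX
  have hX0 : 0 ≤ X := div_nonneg (by linarith) hℓ0.le
  have hXn : X ≤ 5 / 2 * n := by
    rw [hX, div_le_iff₀ hℓ0]
    rw [div_le_iff₀ (by linarith)] at hℓL
    linarith
  have hB : 1 / 75 * (ω / Real.log ω) * p * n * N ≤ 1 / 75 * X * N := by
    have h1 : 1 / 75 * (ω / Real.log ω) * p * n * N = 1 / 75 * (L / Real.log ω) * N := by
      have : ω * p * n = L := by rw [hω]; field_simp
      rw [← this]; ring
    rw [h1, hX]
    gcongr
  -- Below 6 no positive `k` fits under `X / 6`, and the target is less than `6 / 75 * N = 2 / 25 *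
  -- N`. Otherwise `k = ⌊X / 6⌋ ≥ 1` gives `X < 6 (k + 1) ≤ 12 k`, hence `X / 75 ≤ k / 5`.
  by_cases h6 : X < 6
  · refine binomialRandom_lower_tail_le_of_inv_le hn hnN hp₁ (hB.trans ?_)
    nlinarith
  · push Not at h6
    obtain ⟨k, hk⟩ : ∃ k, k = ⌊X / 6⌋₊ := ⟨_, rfl⟩
    have hk1 : 1 ≤ k := hk ▸ (Nat.one_le_floor_iff _).2 (by linarith)
    have hk1' : (1 : ℝ) ≤ k := by exact_mod_cast hk1
    have hk2 : (k : ℝ) ≤ X / 6 := hk ▸ Nat.floor_le (by linarith)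
    have hk3 : X / 6 < k + 1 := hk ▸ Nat.lt_floor_add_one _
    refine binomialRandom_lower_tail_le_of_exp_le (k := k) hn hN hk1 ?_ ?_ (hB.trans ?_)
    · have : (2 * k + 1 : ℝ) ≤ n := by linarith
      exact_mod_cast this
    · rw [← Real.exp_log hp, ← Real.exp_nat_mul, Real.exp_le_exp]
      have h1 : (k : ℝ) * ℓ ≤ X / 6 * ℓ := mul_le_mul_of_nonneg_right hk2 hℓ0.le
      have h2 : X / 6 * ℓ = L / 6 := by rw [hX]; field_simp
      rw [h2, hℓ] at h1
      linarith
    · have : 1 / 75 * X ≤ k / 5 := by linarith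
      nlinarith

theorem theorem1p5 (N : ℕ → ℕ) (p : ℕ → I)
    (hN : ∀ᶠ n : ℕ in atTop, (n : ℝ) * Real.exp (2 * n) ≤ N n) :
    ((∀ᶠ n : ℕ in atTop, (N n : ℝ) ^ (-(2 / (5 * n)) : ℝ) ≤ p n) →
      Tendsto (fun n : ℕ => binomialRandom (Fin (N n)) (p n)
          (exPathBetween (N n) (n + 1) (1 / 16 * n * N n) (1 / 2 * n * N n)))
        atTop (𝓝 1)) ∧
    (∀ ω : ℕ → ℝ, (∀ n, ω n = Real.log (N n) / (n * p n)) →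
      (∀ᶠ n : ℕ in atTop, (N n : ℝ)⁻¹ ≤ p n ∧ (p n : ℝ) ≤ (N n : ℝ) ^ (-(2 / (5 * n)) : ℝ)) →
      Tendsto (fun n : ℕ => binomialRandom (Fin (N n)) (p n)
          (exPathBetween (N n) (n + 1)
            (1 / 75 * (ω n / Real.log (ω n)) * p n * n * N n)
            (8 * (ω n / Real.log (ω n)) * p n * n * N n)))
        atTop (𝓝 1)) := by
  constructor
  · intro hp
    refine tendsto_exPathBetween_of_tails (C := 24) (D := 0) ?_ ?_
    · filter_upwards [hN, hp, eventually_ge_atTop 12] with n hN hp hn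
      exact binomialRandom_lower_tail_dense hn hN hp
    · filter_upwards [eventually_ge_atTop 1] with n hn
      have : {G : SimpleGraph (Fin (N n)) | 1 / 2 * (n : ℝ) * N n <
          (exNumber G (pathGraph (n + 1)) : ℝ)} = ∅ :=
        Set.eq_empty_of_forall_notMem fun G hG => absurd (exNumber_pathGraph_le_half hn G)
          (not_le.2 hG)
      rw [this]
      simp
  · intro ω hω hp
    refine tendsto_exPathBetween_of_tails (C := 24) (D := 1) ?_ ?_
    · filter_upwards [hN, hp, eventually_ge_atTop 12] with n hN hp hn
      exact binomialRandom_lower_tail_sparse hn hN (hω n) hp.1 hp.2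
    · filter_upwards [hN, hp, eventually_ge_atTop 1] with n hN hp hn
      have hN0 : (0 : ℝ) < N n := by
        exact_mod_cast (show 0 < N n from hn.trans (le_of_mul_exp_le hN))
      exact binomialRandom_upper_tail_le hn hN ((inv_pos.2 hN0).trans_le hp.1) (hω n)
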